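/- Let $\mathbb{T}^2=(\mathbb{R}/2\pi\mathbb{Z})^2$ with Lebesgue measure, and let $1<p\le\infty$. There exists a constant $C>0$, depending only on $p$, such that the following holds. Let $f\in H^1(\mathbb{T}^2)$ be real-valued with $\int_{\mathbb{T}^2}f\,dx=0$ and with weak gradient $\nabla f$, and assume that $f=\mu+w$ (that is, $f\,dx=\mu+w\,dx$ as measures), where $\mu\ge 0$ is a bounded (finite) Borel measure on $\mathbb{T}^2$ belonging to $H^{-1}(\mathbb{T}^2)$ and $w\in L^p(\mathbb{T}^2)$. If $\|\nabla f\|_{L^2}>e^2$, then $$\|f\|_{L^2}^2\le C\Big[\|f\|_{L^1}\big(\|\mu\|_{H^{-1}}+\|w\|_{L^p}+\|f\|_{L^1}\big)+1\Big]\,\frac{\|\nabla f\|_{L^2}}{(\log\|\nabla f\|_{L^2})^{1/4}}.$$ Here $H^{-1}(\mathbb{T}^2)$ is the dual of $H^1(\mathbb{T}^2)$, the latter with norm $\big(\|\varphi\|_{L^2}^2+\|\nabla\varphi\|_{L^2}^2\big)^{1/2}$; that is, $\|\mu\|_{H^{-1}}$ is the smallest $K\ge0$ with $\left|\int\varphi\,d\mu\right|\le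 K\|\varphi\|_{H^1}$ for all $\varphi\in C^\infty(\mathbb{T}^2)$. -/

import Mathlib

open MeasureTheory Real
open scoped ENNReal ContDiff

instance Torus2.factTwoPiPos : Fact (0 < 2 * π) := ⟨Real.two_pi_pos⟩

/-- The flat two-dimensional torus `(ℝ / 2πℤ)²`, that is `[-π, π]²` with opposite sides identified.
Its `volume` is Lebesgue measure, of total mass `4π²`. -/
abbrev Torus2 : Type := Fin 2 → AddCircle (2 * π)

/-- The quotient map `ℝ² → (ℝ / 2πℤ)²`. -/
noncomputable def Torus2.mk (x : Fin 2 → ℝ) : Torus2 := fun i => (x i : AddCircle (2 * π))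

/-- A real function on the torus is smooth when its periodic lift to `ℝ²` is `C^∞`. -/
def Torus2.Smooth (φ : Torus2 → ℝ) : Prop :=
  ContDiff ℝ ∞ (fun x : Fin 2 → ℝ => φ (Torus2.mk x))

/-- The classical partial derivative `∂ᵢ φ` of a (smooth) function on the torus. -/
noncomputable def Torus2.partialDeriv (i : Fin 2) (φ : Torus2 → ℝ) (x : Torus2) : ℝ :=
  deriv (fun t : ℝ => φ (x + Pi.single i (t : AddCircle (2 * π)))) 0

/-- `f` belongs to `H¹(𝕋²)` and `G` is its weak gradient: `f` and `G` are square integrable, and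
`∫ f ∂ᵢφ = - ∫ Gᵢ φ` for every smooth test function `φ` and every `i`. -/
structure Torus2.HasH1Gradient (f : Torus2 → ℝ) (G : Torus2 → EuclideanSpace ℝ (Fin 2)) :
    Prop where
  memLp : MemLp f 2 volume
  memLp_grad : MemLp G 2 volume
  integral_eq : ∀ φ : Torus2 → ℝ, Torus2.Smooth φ → ∀ i : Fin 2,
    ∫ x, f x * Torus2.partialDeriv i φ x = - ∫ x, G x i * φ x

/-- The `H¹` norm `(∫ φ² + |∇φ|²)^{1/2}` of a smooth function on the torus. -/
noncomputable def Torus2.h1Norm (φ : Torus2 → ℝ) : ℝ :=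
  √(∫ x, (φ x ^ 2 + ∑ i, Torus2.partialDeriv i φ x ^ 2))

/-- `K` is a bound for the functional `φ ↦ ∫ φ dμ` with respect to the `H¹` norm
(on smooth functions, which are dense in `H¹`). -/
def Torus2.IsHNegBound (μ : Measure Torus2) (K : ℝ) : Prop :=
  0 ≤ K ∧ ∀ φ : Torus2 → ℝ, Torus2.Smooth φ → |∫ x, φ x ∂μ| ≤ K * Torus2.h1Norm φ

/-- The measure `μ` belongs to `H⁻¹(𝕋²)`, the dual of `H¹(𝕋²)`. -/
def Torus2.MemHNeg (μ : Measure Torus2) : Prop :=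
  ∃ K : ℝ, Torus2.IsHNegBound μ K

/-- The `H⁻¹` norm of `μ`: the norm of `φ ↦ ∫ φ dμ` in the dual of `H¹(𝕋²)`
(meaningful when `Torus2.MemHNeg μ`). -/
noncomputable def Torus2.hNegNorm (μ : Measure Torus2) : ℝ :=
  sInf {K : ℝ | Torus2.IsHNegBound μ K}

/-! Write N for the L² norm of the gradient. A function in H¹ correlates with its small translates:
∫ f(x) f(x + y) dx ≥ ‖f‖₂² - 2‖y‖ N ‖f‖₂. Averaging over ‖y‖ ≤ δ and using Tonelli bounds the left
side by ‖f‖₁ S / (4δ²), where S is the largest mass of |f| on a ball of radius δ. Absorbing the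
linear term gives ‖f‖₂² ≤ ‖f‖₁ S / (2δ²) + 4δ²N² (`lpNorm_sq_le_of_setIntegral_closedBall_le`).

It remains to see that |f| does not concentrate. As f - w = μ ≥ 0, |f| is dominated by μ + |w|.
Points have zero capacity in dimension two: testing μ against a regularised logarithm gives a ball
mass O(‖μ‖_{H⁻¹} (log 1/δ)^{-1/2}) (`IsHNegBound.measureReal_closedBall_le`), while by Hölder |w|
contributes a positive power of δ, which is smaller. Thus S = O((log 1/δ)^{-1/2}), and δ² = 1 / (N
(log N)^{1/4}) makes both terms of order N / (log N)^{1/4}. -/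

namespace Torus2

open Filter Topology Metric

/-! ### Lifting to the plane and calculus of smooth functions -/

theorem isOpenQuotientMap_mk : IsOpenQuotientMap Torus2.mk :=
  IsOpenQuotientMap.piMap fun _ => QuotientAddGroup.isOpenQuotientMap_mk

theorem mk_sub (x y : Fin 2 → ℝ) : mk (x - y) = mk x - mk y := rfl

theorem mk_add (x y : Fin 2 → ℝ) : mk (x + y) = mk x + mk y := rfl

theorem mk_single (i : Fin 2) (t : ℝ) :
    mk (Pi.single i t) = Pi.single i (t : AddCircle (2 * π)) := by
  ext j
  by_cases h : j = i
  · subst h; simp [mk]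
  · simp [mk, h]

theorem continuous_iff_lift {φ : Torus2 → ℝ} :
    Continuous φ ↔ Continuous fun x => φ (mk x) :=
  isOpenQuotientMap_mk.isQuotientMap.continuous_iff

/-- The point `t eᵢ` of the torus. -/
@[irreducible] noncomputable def axis (i : Fin 2) (t : ℝ) : Torus2 :=
  Pi.single i (t : AddCircle (2 * π))

theorem axis_eq_mk (i : Fin 2) (t : ℝ) : axis i t = mk (Pi.single i t) := by
  rw [axis, mk_single]

theorem axis_zero (i : Fin 2) : axis i 0 = 0 := by
  rw [axis]; exact Pi.single_zero i

theorem exists_coe_eq_abs_eq_norm (z : AddCircle (2 * π)) :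
    ∃ t : ℝ, (t : AddCircle (2 * π)) = z ∧ |t| = ‖z‖ := by
  have hz : z ∈ ((↑) '' Set.Icc (-π) (-π + 2 * π) : Set (AddCircle (2 * π))) := by
    rw [AddCircle.coe_image_Icc_eq]; exact Set.mem_univ z
  obtain ⟨t, ht, rfl⟩ := hz
  refine ⟨t, rfl, ?_⟩
  rw [eq_comm, AddCircle.norm_coe_eq_abs_iff _ two_pi_pos.ne', abs_of_pos two_pi_pos, abs_le]
  constructor <;> linarith [ht.1, ht.2]

/-- Splits a translation into two axis moves, so that each involves a single partial derivative;
this is the source of the factor 2 in the translation estimates. -/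
theorem exists_eq_axis_add_axis (y : Torus2) :
    ∃ s t : ℝ, y = axis 0 s + axis 1 t ∧ |s| ≤ ‖y‖ ∧ |t| ≤ ‖y‖ := by
  obtain ⟨s, hs, hs'⟩ := exists_coe_eq_abs_eq_norm (y 0)
  obtain ⟨t, ht, ht'⟩ := exists_coe_eq_abs_eq_norm (y 1)
  refine ⟨s, t, ?_, hs'.trans_le (norm_le_pi_norm y 0), ht'.trans_le (norm_le_pi_norm y 1)⟩
  rw [axis, axis]
  ext j
  fin_cases j <;> simp [hs, ht]

namespace Smooth

variable {φ ψ : Torus2 → ℝ}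

theorem continuous (hφ : Smooth φ) : Continuous φ :=
  continuous_iff_lift.2 (ContDiff.continuous hφ)

theorem comp_sub (hφ : Smooth φ) (a : Torus2) : Smooth fun x => φ (x - a) := by
  obtain ⟨b, rfl⟩ := isOpenQuotientMap_mk.surjective a
  unfold Smooth
  simp only [← mk_sub]
  exact ContDiff.comp (g := fun x => φ (mk x)) hφ (contDiff_id.sub contDiff_const)

theorem add (hφ : Smooth φ) (hψ : Smooth ψ) : Smooth fun x => φ x + ψ x :=
  ContDiff.add hφ hψ

theorem mul (hφ : Smooth φ) (hψ : Smooth ψ) : Smooth fun x => φ x * ψ x :=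
  ContDiff.mul hφ hψ

theorem const (c : ℝ) : Smooth fun _ => c := contDiff_const

theorem partialDeriv_mk (hφ : Smooth φ) (i : Fin 2) (x : Fin 2 → ℝ) :
    partialDeriv i φ (mk x) = fderiv ℝ (fun x => φ (mk x)) x (Pi.single i 1) := by
  have h := (ContDiff.differentiable hφ (by simp) x).hasFDerivAt
  unfold partialDeriv
  simp only [← mk_single, ← mk_add]
  have h2 : HasDerivAt (fun t : ℝ => x + Pi.single i t) (Pi.single i 1) 0 := by
    have := (hasDerivAt_single (𝕜 := ℝ) i (0 : ℝ)).const_add x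
    simpa using this
  have h3 : HasFDerivAt (fun x => φ (mk x)) (fderiv ℝ (fun x => φ (mk x)) x)
      (x + Pi.single i (0 : ℝ)) := by simpa using h
  exact (h3.comp_hasDerivAt (0 : ℝ) h2).deriv

theorem continuous_partialDeriv (hφ : Smooth φ) (i : Fin 2) :
    Continuous (partialDeriv i φ) := by
  rw [continuous_iff_lift]
  simp only [hφ.partialDeriv_mk]
  exact (ContDiff.continuous_fderiv hφ (by simp)).clm_apply continuous_const

theorem hasDerivAt (hφ : Smooth φ) (i : Fin 2) (x : Torus2) (t : ℝ) :
    HasDerivAt (fun s : ℝ => φ (x + axis i s)) (partialDeriv i φ (x + axis i t)) t := by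
  obtain ⟨y, rfl⟩ := isOpenQuotientMap_mk.surjective x
  simp only [axis_eq_mk, ← mk_add]
  rw [hφ.partialDeriv_mk]
  have h := (ContDiff.differentiable hφ (by simp) (y + Pi.single i t)).hasFDerivAt
  have h2 := (hasDerivAt_single (𝕜 := ℝ) i t).const_add y
  exact h.comp_hasDerivAt t h2

end Smooth

theorem partialDeriv_comp_sub (i : Fin 2) (φ : Torus2 → ℝ) (a x : Torus2) :
    partialDeriv i (fun y => φ (y - a)) x = partialDeriv i φ (x - a) := by
  simp only [partialDeriv, add_sub_right_comm]

theorem h1Norm_comp_sub (φ : Torus2 → ℝ) (a : Torus2) :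
    h1Norm (fun y => φ (y - a)) = h1Norm φ := by
  simp only [h1Norm, partialDeriv_comp_sub]
  rw [integral_sub_right_eq_self (fun x => φ x ^ 2 + ∑ i, partialDeriv i φ x ^ 2)]

/-! ### Density of smooth functions -/

/-- The coordinate function `cos xᵢ` on the torus. -/
noncomputable def cosCoord (i : Fin 2) (x : Torus2) : ℝ := Real.Angle.cos (x i)

/-- The coordinate function `sin xᵢ` on the torus. -/
noncomputable def sinCoord (i : Fin 2) (x : Torus2) : ℝ := Real.Angle.sin (x i)

theorem cosCoord_mk (i : Fin 2) (x : Fin 2 → ℝ) : cosCoord i (mk x) = Real.cos (x i) :=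
  Real.Angle.cos_coe _

theorem sinCoord_mk (i : Fin 2) (x : Fin 2 → ℝ) : sinCoord i (mk x) = Real.sin (x i) :=
  Real.Angle.sin_coe _

theorem smooth_cosCoord (i : Fin 2) : Smooth (cosCoord i) := by
  unfold Smooth
  simp only [cosCoord_mk]
  fun_prop

theorem smooth_sinCoord (i : Fin 2) : Smooth (sinCoord i) := by
  unfold Smooth
  simp only [sinCoord_mk]
  fun_prop

/-- The algebra of smooth functions on the torus. -/
def smoothSubalgebra : Subalgebra ℝ C(Torus2, ℝ) where
  carrier := {φ | Smooth φ}
  mul_mem' ha hb := Smooth.mul ha hb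
  add_mem' ha hb := Smooth.add ha hb
  algebraMap_mem' c := Smooth.const c

/-- Stone–Weierstrass: the sines and cosines of the coordinates already separate points. -/
theorem smoothSubalgebra_topologicalClosure : smoothSubalgebra.topologicalClosure = ⊤ := by
  apply ContinuousMap.subalgebra_topologicalClosure_eq_top_of_separatesPoints
  intro x y hxy
  obtain ⟨x, rfl⟩ := isOpenQuotientMap_mk.surjective x
  obtain ⟨y, rfl⟩ := isOpenQuotientMap_mk.surjective y
  obtain ⟨i, hi⟩ := Function.ne_iff.1 hxy
  by_cases hc : cosCoord i (mk x) = cosCoord i (mk y)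
  · refine ⟨_, ⟨⟨sinCoord i, (smooth_sinCoord i).continuous⟩, smooth_sinCoord i, rfl⟩, ?_⟩
    intro hs
    simp only [ContinuousMap.coe_mk, cosCoord_mk, sinCoord_mk] at hc hs
    exact hi (Real.Angle.cos_sin_inj hc hs)
  · exact ⟨_, ⟨⟨cosCoord i, (smooth_cosCoord i).continuous⟩, smooth_cosCoord i, rfl⟩, hc⟩

/-- Smooth functions are dense in `L²`. -/
theorem exists_smooth_lpNorm_sub_le {f : Torus2 → ℝ} (hf : MemLp f 2 volume) {ε : ℝ}
    (hε : 0 < ε) : ∃ φ : Torus2 → ℝ, Smooth φ ∧ lpNorm (f - φ) 2 volume ≤ ε := by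
  have hd : DenseRange (fun φ : smoothSubalgebra =>
      ContinuousMap.toLp (E := ℝ) 2 (volume : Measure Torus2) ℝ (φ : C(Torus2, ℝ))) := by
    refine DenseRange.comp (ContinuousMap.toLp_denseRange ℝ volume ℝ (by simp)) ?_
      (ContinuousLinearMap.continuous _)
    rw [DenseRange, Subtype.range_coe]
    intro x
    have : x ∈ smoothSubalgebra.topologicalClosure := by
      rw [smoothSubalgebra_topologicalClosure]; trivial
    exact this
  obtain ⟨φ, hφ⟩ := Metric.denseRange_iff.1 hd (hf.toLp f) ε hε
  refine ⟨φ, φ.2, ?_⟩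
  rw [Lp.dist_def] at hφ
  rw [← toReal_eLpNorm
    (hf.1.sub (ContinuousMap.continuous (φ : C(Torus2, ℝ))).aestronglyMeasurable)]
  refine le_of_eq_of_le (congrArg ENNReal.toReal (eLpNorm_congr_ae ?_)) hφ.le
  filter_upwards [hf.coeFn_toLp, ContinuousMap.coeFn_toLp (p := 2) (𝕜 := ℝ)
    (volume : Measure Torus2) (φ : C(Torus2, ℝ))] with x h1 h2
  simp only [Pi.sub_apply, h1, h2]


/-! ### L² pairings and translates of an H¹ function -/

theorem lpNorm_two_sq_eq_integral {α : Type*} [MeasurableSpace α] {ν : Measure α} {f : α → ℝ}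
    (hf : MemLp f 2 ν) : lpNorm f 2 ν ^ 2 = ∫ x, f x * f x ∂ν := by
  rw [← toReal_eLpNorm hf.1, ← Lp.norm_toLp f hf, ← real_inner_self_eq_norm_sq, L2.inner_def]
  refine integral_congr_ae ?_
  filter_upwards [hf.coeFn_toLp] with x hx
  simp [hx, sq]

theorem abs_integral_mul_le_lpNorm {α : Type*} [MeasurableSpace α] {ν : Measure α} {f g : α → ℝ}
    (hf : MemLp f 2 ν) (hg : MemLp g 2 ν) :
    |∫ x, f x * g x ∂ν| ≤ lpNorm f 2 ν * lpNorm g 2 ν := by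
  rw [← toReal_eLpNorm hf.1, ← Lp.norm_toLp f hf, ← toReal_eLpNorm hg.1, ← Lp.norm_toLp g hg]
  refine le_of_eq_of_le ?_ (abs_real_inner_le_norm _ _)
  rw [L2.inner_def]
  congr 1
  refine integral_congr_ae ?_
  filter_upwards [hf.coeFn_toLp, hg.coeFn_toLp] with x hx hy
  simp [hx, hy, mul_comm]

theorem lpNorm_comp_add_right {p : ℝ≥0∞} {f : Torus2 → ℝ} (hf : MemLp f p volume) (a : Torus2) :
    lpNorm (fun x => f (x + a)) p volume = lpNorm f p volume := by
  have h := measurePreserving_add_right (volume : Measure Torus2) a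
  rw [← toReal_eLpNorm hf.1, ← eLpNorm_comp_measurePreserving hf.1 h, toReal_eLpNorm]
  · rfl
  · exact hf.1.comp_measurePreserving h

theorem memLp_comp_add_right {p : ℝ≥0∞} {f : Torus2 → ℝ} (hf : MemLp f p volume) (a : Torus2) :
    MemLp (fun x => f (x + a)) p volume :=
  hf.comp_measurePreserving (measurePreserving_add_right (volume : Measure Torus2) a)

theorem memLp_of_continuous {φ : Torus2 → ℝ} (hφ : Continuous φ) (p : ℝ≥0∞) :
    MemLp φ p volume := by
  obtain ⟨C, hC⟩ := isCompact_univ.exists_bound_of_continuousOn hφ.continuousOn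
  exact MemLp.of_bound hφ.aestronglyMeasurable C (ae_of_all _ fun x => hC x trivial)

theorem Smooth.comp_add {φ : Torus2 → ℝ} (hφ : Smooth φ) (a : Torus2) :
    Smooth fun x => φ (x + a) := by
  simpa using hφ.comp_sub (-a)

theorem partialDeriv_comp_add (i : Fin 2) (φ : Torus2 → ℝ) (a x : Torus2) :
    partialDeriv i (fun y => φ (y + a)) x = partialDeriv i φ (x + a) := by
  simp only [partialDeriv, add_right_comm]

attribute [local irreducible] partialDeriv

theorem hasDerivAt_integral_mul_of_bounded_deriv {α : Type*} [MeasurableSpace α] {ν : Measure α}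
    {f : α → ℝ} (hf : Integrable f ν) {g g' : ℝ → α → ℝ} {C : ℝ} (hg : ∀ s, MemLp (g s) ⊤ ν)
    (hg' : ∀ s, MemLp (g' s) ⊤ ν) (hC : ∀ s x, ‖g' s x‖ ≤ C)
    (hd : ∀ x s, HasDerivAt (fun s => g s x) (g' s x) s) (t : ℝ) :
    HasDerivAt (fun s => ∫ x, f x * g s x ∂ν) (∫ x, f x * g' t x ∂ν) t :=
  (hasDerivAt_integral_of_dominated_loc_of_deriv_le
    (F := fun s x => f x * g s x) (F' := fun s x => f x * g' s x)
    (x₀ := t) (s := Set.univ) (bound := fun x => ‖f x‖ * C) univ_mem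
    (Eventually.of_forall fun s => hf.1.mul (hg s).1)
    (hf.mul_of_top_left (hg t))
    (hf.1.mul (hg' t).1)
    (ae_of_all _ fun x s _ => by
      rw [norm_mul]
      exact mul_le_mul_of_nonneg_left (hC _ _) (norm_nonneg _))
    (hf.norm.mul_const C)
    (ae_of_all _ fun x s _ => (hd x s).const_mul (f x))).2

namespace HasH1Gradient

variable {f : Torus2 → ℝ} {G : Torus2 → EuclideanSpace ℝ (Fin 2)}

theorem memLp_grad_apply (h : HasH1Gradient f G) (i : Fin 2) :
    MemLp (fun x => G x i) 2 volume :=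
  h.memLp_grad.mono
    ((EuclideanSpace.proj (𝕜 := ℝ) i).continuous.comp_aestronglyMeasurable h.memLp_grad.1)
    (ae_of_all _ fun x => PiLp.norm_apply_le (G x) i)

theorem lpNorm_grad_apply_le (h : HasH1Gradient f G) (i : Fin 2) :
    lpNorm (fun x => G x i) 2 volume ≤ lpNorm G 2 volume := by
  rw [← toReal_eLpNorm h.memLp_grad.1, ← toReal_eLpNorm (h.memLp_grad_apply i).1]
  exact ENNReal.toReal_mono h.memLp_grad.2.ne
    (eLpNorm_mono fun x => PiLp.norm_apply_le (G x) i)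

/-- The translation acts on the smooth factor, so one may differentiate under the integral; the weak
gradient identity then moves the derivative onto `f`. -/
theorem hasDerivAt_integral (h : HasH1Gradient f G) {φ : Torus2 → ℝ} (hφ : Smooth φ)
    (i : Fin 2) (t : ℝ) :
    HasDerivAt (fun s : ℝ => ∫ x, f x * φ (x + axis i s))
      (-∫ x, G x i * φ (x + axis i t)) t := by
  have hd := hφ.continuous_partialDeriv i
  have hdc : ∀ a : Torus2, Continuous fun x => partialDeriv i φ (x + a) := fun a => by
    have := (hφ.comp_add a).continuous_partialDeriv i
    rwa [show partialDeriv i (fun x => φ (x + a)) = fun x => partialDeriv i φ (x + a) from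
      funext fun x => partialDeriv_comp_add i φ a x] at this
  obtain ⟨C, hC⟩ := isCompact_univ.exists_bound_of_continuousOn hd.continuousOn
  have hfi : Integrable f volume := h.memLp.integrable (by norm_num)
  have key := hasDerivAt_integral_mul_of_bounded_deriv hfi
    (g := fun s x => φ (x + axis i s))
    (g' := fun s x => partialDeriv i φ (x + axis i s))
    (fun s => memLp_of_continuous
      (hφ.comp_add (axis i s)).continuous ⊤)
    (fun s => memLp_of_continuous (hdc (axis i s)) ⊤)
    (fun s x => hC (x + axis i s) (Set.mem_univ _)) (fun x s => hφ.hasDerivAt i x s) t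
  have := h.integral_eq _ (hφ.comp_add (axis i t)) i
  simp only [partialDeriv_comp_add] at this
  rw [← this]
  exact key

/-- Mean value inequality: by Cauchy–Schwarz and translation invariance the derivative in `s` is
bounded uniformly. -/
theorem abs_integral_translate_single_sub_le (h : HasH1Gradient f G) {φ : Torus2 → ℝ}
    (hφ : Smooth φ) (i : Fin 2) (s : ℝ) :
    |(∫ x, f x * φ (x + axis i s)) - ∫ x, f x * φ x| ≤
      lpNorm G 2 volume * lpNorm φ 2 volume * |s| := by
  have hφ2 := memLp_of_continuous hφ.continuous 2
  have := Convex.norm_image_sub_le_of_norm_hasDerivWithin_le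
    (f := fun s : ℝ => ∫ x, f x * φ (x + axis i s))
    (C := lpNorm G 2 volume * lpNorm φ 2 volume) (s := Set.univ) (x := 0) (y := s)
    (fun t _ => (h.hasDerivAt_integral hφ i t).hasDerivWithinAt) (fun t _ => by
      rw [norm_neg]
      refine (abs_integral_mul_le_lpNorm (h.memLp_grad_apply i)
        (memLp_comp_add_right hφ2 _)).trans ?_
      rw [lpNorm_comp_add_right hφ2]
      exact mul_le_mul_of_nonneg_right (h.lpNorm_grad_apply_le i) lpNorm_nonneg)
    convex_univ trivial trivial
  simpa [axis_zero] using this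

theorem abs_integral_translate_sub_le (h : HasH1Gradient f G) {φ : Torus2 → ℝ}
    (hφ : Smooth φ) (y : Torus2) :
    |(∫ x, f x * φ (x + y)) - ∫ x, f x * φ x| ≤
      2 * ‖y‖ * lpNorm G 2 volume * lpNorm φ 2 volume := by
  obtain ⟨s, t, hy, b1, b2⟩ := exists_eq_axis_add_axis y
  have h1 := h.abs_integral_translate_single_sub_le
    (hφ.comp_add (axis 1 t)) 0 s
  have h2 := h.abs_integral_translate_single_sub_le hφ 1 t
  rw [lpNorm_comp_add_right (memLp_of_continuous hφ.continuous 2)] at h1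
  simp only [add_assoc, ← hy] at h1
  have hN : 0 ≤ lpNorm G 2 volume * lpNorm φ 2 volume := mul_nonneg lpNorm_nonneg lpNorm_nonneg
  have c1 := mul_le_mul_of_nonneg_left b1 hN
  have c2 := mul_le_mul_of_nonneg_left b2 hN
  calc _ ≤ _ := abs_sub_le _ (∫ x, f x * φ (x + axis 1 t)) _
    _ ≤ _ := add_le_add (h1.trans c1) (h2.trans c2)
    _ = _ := by ring

/-- The bound for smooth `φ` involves only its L² norm, so it passes to `φ → f` by density. -/
theorem lpNorm_sq_le_integral_translate (h : HasH1Gradient f G) (y : Torus2) :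
    lpNorm f 2 volume ^ 2 ≤ (∫ x, f x * f (x + y)) +
      2 * ‖y‖ * lpNorm G 2 volume * lpNorm f 2 volume := by
  set N := lpNorm G 2 volume
  set B := lpNorm f 2 volume
  have hN : 0 ≤ N := lpNorm_nonneg
  have hB : 0 ≤ B := lpNorm_nonneg
  refine le_of_forall_pos_le_add fun ε hε => ?_
  -- Replacing `φ` by `f` costs `B * d` in each of the two pairings and `2 * ‖y‖ * N * d` in the
  -- error term; the `1` keeps `c` positive.
  set c := 2 * B + 2 * ‖y‖ * N + 1 with hc
  have hc0 : 0 < c := by positivity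
  obtain ⟨φ, hφ, hd⟩ := exists_smooth_lpNorm_sub_le h.memLp (div_pos hε hc0)
  have hφ2 := memLp_of_continuous hφ.continuous 2
  have hsub : MemLp (f - φ) 2 volume := h.memLp.sub hφ2
  set d := lpNorm (f - φ) 2 volume
  have e1 := abs_integral_mul_le_lpNorm h.memLp hsub
  have e2 := abs_integral_mul_le_lpNorm h.memLp (memLp_comp_add_right hsub y)
  rw [lpNorm_comp_add_right hsub] at e2
  have e3 := h.abs_integral_translate_sub_le hφ y
  have e4 : lpNorm φ 2 volume ≤ B + d := by
    have := lpNorm_sub_le h.memLp (g := f - φ) (by norm_num)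
    rwa [sub_sub_cancel] at this
  have i1 : ∫ x, f x * (f - φ) x = (∫ x, f x * f x) - ∫ x, f x * φ x := by
    refine Eq.trans ?_ (integral_sub (h.memLp.integrable_mul h.memLp)
      (h.memLp.integrable_mul hφ2))
    simp only [Pi.sub_apply, mul_sub]
  have i2 : ∫ x, f x * (f - φ) (x + y) = (∫ x, f x * f (x + y)) - ∫ x, f x * φ (x + y) := by
    refine Eq.trans ?_ (integral_sub (h.memLp.integrable_mul (memLp_comp_add_right h.memLp y))
      (h.memLp.integrable_mul (memLp_comp_add_right hφ2 y)))
    simp only [Pi.sub_apply, mul_sub]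
  rw [i1, ← lpNorm_two_sq_eq_integral h.memLp] at e1
  rw [i2] at e2
  have e5 : 2 * ‖y‖ * N * lpNorm φ 2 volume ≤ 2 * ‖y‖ * N * (B + d) := by gcongr
  have e6 : d * c ≤ ε := (le_div_iff₀ hc0).1 hd
  have e7 : 0 ≤ d := lpNorm_nonneg
  rw [abs_le] at e1 e2 e3
  nlinarith [e1.2, e2.1, e3.1]

end HasH1Gradient


/-! ### Averaging the correlation over a small ball -/

/-- The metric is the sup metric, so the ball is a square of side `2 * δ`, which does not overlap
itself when `δ ≤ π`. -/
theorem volume_closedBall (x : Torus2) {δ : ℝ} (hδ : 0 ≤ δ) (hδ' : δ ≤ π) :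
    volume (closedBall x δ) = ENNReal.ofReal (4 * δ ^ 2) := by
  rw [MeasureTheory.volume_pi_closedBall _ hδ]
  simp only [AddCircle.volume_closedBall]
  rw [min_eq_right (by linarith), Finset.prod_const, Finset.card_univ, Fintype.card_fin,
    ← ENNReal.ofReal_pow (by positivity)]
  ring_nf

theorem setLIntegral_closedBall_zero_add (F : Torus2 → ℝ≥0∞) (x : Torus2) (δ : ℝ) :
    ∫⁻ y in closedBall 0 δ, F (x + y) = ∫⁻ y in closedBall x δ, F y := by
  have h := (measurePreserving_add_left (volume : Measure Torus2) x).setLIntegral_comp_preimage_emb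
    (MeasurableEquiv.addLeft x).measurableEmbedding F (closedBall x δ)
  rw [← h]
  congr 2
  ext y
  simp [dist_eq_norm]

theorem aemeasurable_mul_translate {F : Torus2 → ℝ≥0∞} (hF : AEMeasurable F volume)
    (s : Set Torus2) :
    AEMeasurable (Function.uncurry fun x y => F x * F (x + y))
      ((volume : Measure Torus2).prod (volume.restrict s)) := by
  have h1 : AEMeasurable (fun p : Torus2 × Torus2 => F p.1) (volume.prod volume) :=
    hF.comp_quasiMeasurePreserving Measure.quasiMeasurePreserving_fst
  have h2 : AEMeasurable (fun p : Torus2 × Torus2 => F (p.1 + p.2)) (volume.prod volume) :=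
    hF.comp_quasiMeasurePreserving (Measure.quasiMeasurePreserving_snd.comp
      (measurePreserving_prod_add (volume : Measure Torus2)
        (volume : Measure Torus2)).quasiMeasurePreserving)
  exact (h1.mul h2).mono_ac
    (Measure.AbsolutelyContinuous.rfl.prod Measure.restrict_le_self.absolutelyContinuous)

/-- Tonelli: with `x` fixed, the integral over `y` is the mass of `F` on the ball centred at `x`. -/
theorem setLIntegral_lintegral_mul_translate_le {F : Torus2 → ℝ≥0∞} (hF : AEMeasurable F volume)
    {δ : ℝ} {S : ℝ≥0∞} (hS : ∀ x, ∫⁻ y in closedBall x δ, F y ≤ S) :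
    ∫⁻ y in closedBall 0 δ, ∫⁻ x, F x * F (x + y) ≤ (∫⁻ x, F x) * S := by
  rw [← lintegral_lintegral_swap (aemeasurable_mul_translate hF _)]
  calc ∫⁻ x, ∫⁻ y in closedBall 0 δ, F x * F (x + y)
      ≤ ∫⁻ x, F x * S := by
        refine lintegral_mono_ae ?_
        filter_upwards with x
        have hm : AEMeasurable (fun y => F (x + y)) (volume.restrict (closedBall 0 δ)) :=
          (hF.comp_quasiMeasurePreserving (measurePreserving_add_left
            (volume : Measure Torus2) x).quasiMeasurePreserving).restrict
        rw [lintegral_const_mul'' _ hm, setLIntegral_closedBall_zero_add]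
        gcongr
        exact hS x
    _ = _ := lintegral_mul_const'' _ hF

namespace HasH1Gradient

variable {f : Torus2 → ℝ} {G : Torus2 → EuclideanSpace ℝ (Fin 2)}

theorem lpNorm_sq_le_of_setIntegral_closedBall_le (h : HasH1Gradient f G) {δ S : ℝ} (hδ : 0 < δ)
    (hδ' : δ ≤ π) (hS : ∀ x, ∫ y in closedBall x δ, |f y| ≤ S) :
    lpNorm f 2 volume ^ 2 ≤
      lpNorm f 1 volume * S / (2 * δ ^ 2) + 4 * δ ^ 2 * lpNorm G 2 volume ^ 2 := by
  set N := lpNorm G 2 volume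
  set B := lpNorm f 2 volume
  have hfi : Integrable f volume := h.memLp.integrable (by norm_num)
  have hS0 : 0 ≤ S := (integral_nonneg fun y => abs_nonneg (f y)).trans (hS 0)
  have hA : ∫⁻ x, ‖f x‖ₑ = ENNReal.ofReal (lpNorm f 1 volume) := by
    rw [ofReal_lpNorm (memLp_one_iff_integrable.2 hfi), eLpNorm_one_eq_lintegral_enorm]
  have hS' : ∀ x, ∫⁻ y in closedBall x δ, ‖f y‖ₑ ≤ ENNReal.ofReal S := fun x => by
    rw [← ofReal_integral_norm_eq_lintegral_enorm hfi.integrableOn]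
    exact ENNReal.ofReal_le_ofReal (hS x)
  have key := setLIntegral_lintegral_mul_translate_le hfi.1.enorm hS'
  have hlow : ∀ y ∈ closedBall (0 : Torus2) δ, ENNReal.ofReal (B ^ 2 - 2 * δ * N * B) ≤
      ∫⁻ x, ‖f x‖ₑ * ‖f (x + y)‖ₑ := fun y hy => by
    rw [mem_closedBall_zero_iff] at hy
    have h1 := h.lpNorm_sq_le_integral_translate y
    have h2 : 2 * ‖y‖ * N * B ≤ 2 * δ * N * B := by
      have : 0 ≤ N * B := mul_nonneg lpNorm_nonneg lpNorm_nonneg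
      nlinarith
    have h3 := h.memLp.integrable_mul (memLp_comp_add_right h.memLp y)
    calc ENNReal.ofReal (B ^ 2 - 2 * δ * N * B)
        ≤ ENNReal.ofReal (∫ x, ‖f x * f (x + y)‖) := by
          refine ENNReal.ofReal_le_ofReal ?_
          have := (le_abs_self _).trans (norm_integral_le_integral_norm (μ := volume)
            fun x => f x * f (x + y))
          linarith
      _ = ∫⁻ x, ‖f x * f (x + y)‖ₑ := ofReal_integral_norm_eq_lintegral_enorm h3
      _ = _ := by simp only [enorm_mul]
  have hint := setLIntegral_mono_ae' (μ := (volume : Measure Torus2))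
    isClosed_closedBall.measurableSet (ae_of_all _ hlow)
  rw [setLIntegral_const, volume_closedBall 0 hδ.le hδ'] at hint
  have hfin := hint.trans key
  rw [hA, ← ENNReal.ofReal_mul' (by positivity), ← ENNReal.ofReal_mul' hS0,
    ENNReal.ofReal_le_ofReal_iff (mul_nonneg lpNorm_nonneg hS0)] at hfin
  have h4 : B ^ 2 - 2 * δ * N * B ≤ lpNorm f 1 volume * S / (4 * δ ^ 2) :=
    (le_div_iff₀ (by positivity)).2 hfin
  have h5 : lpNorm f 1 volume * S / (2 * δ ^ 2) = 2 * (lpNorm f 1 volume * S / (4 * δ ^ 2)) := by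
    field_simp; ring
  rw [h5]
  -- Absorption of the linear term: `4 * δ * N * B ≤ B ^ 2 + 4 * δ ^ 2 * N ^ 2`.
  nlinarith [sq_nonneg (B - 2 * δ * N)]

end HasH1Gradient


/-! ### The logarithmically divergent integral in two dimensions -/

theorem integral_comp_norm_addCircle {F : ℝ → ℝ} (hF : Continuous F) :
    ∫ z : AddCircle (2 * π), F ‖z‖ = 2 * ∫ t in 0..π, F t := by
  have hpi := pi_pos
  have hc : Continuous fun t : ℝ => F |t| := hF.comp continuous_abs
  rw [← AddCircle.intervalIntegral_preimage (2 * π) (-π) fun z => F ‖z‖]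
  have h1 : ∫ t in (-π)..(-π + 2 * π), F ‖(t : AddCircle (2 * π))‖ = ∫ t in (-π)..π, F |t| := by
    rw [show -π + 2 * π = π by ring]
    refine intervalIntegral.integral_congr fun t ht => ?_
    rw [Set.uIcc_of_le (by linarith)] at ht
    rw [(AddCircle.norm_coe_eq_abs_iff _ two_pi_pos.ne').2]
    rw [abs_of_pos two_pi_pos, abs_le]
    constructor <;> linarith [ht.1, ht.2]
  have h2 : ∫ t in 0..π, F |t| = ∫ t in 0..π, F t := by
    refine intervalIntegral.integral_congr fun t ht => ?_
    rw [Set.uIcc_of_le hpi.le] at ht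
    simp only [abs_of_nonneg ht.1]
  have h3 : ∫ t in (-π)..0, F |t| = ∫ t in 0..π, F |t| := by
    rw [← neg_zero, ← intervalIntegral.integral_comp_neg]
    simp
  rw [h1, ← intervalIntegral.integral_add_adjacent_intervals (hc.intervalIntegrable (-π) 0)
    (hc.intervalIntegrable 0 π), h3, h2]
  ring

theorem continuous_inv_add_abs_sq {a : ℝ} (ha : 0 < a) :
    Continuous fun t : ℝ => ((a + |t|) ^ 2)⁻¹ := by
  refine Continuous.inv₀ (by fun_prop) fun t => ?_
  positivity

theorem integral_inv_add_norm_sq_le {a : ℝ} (ha : 0 < a) :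
    ∫ z : AddCircle (2 * π), ((a + ‖z‖) ^ 2)⁻¹ ≤ 2 * a⁻¹ := by
  have hpi := pi_pos
  have h := integral_comp_norm_addCircle (continuous_inv_add_abs_sq ha)
  simp only [abs_norm] at h
  rw [h]
  have h2 : ∫ t in 0..π, ((a + |t|) ^ 2)⁻¹ = -(a + π)⁻¹ - -(a + 0)⁻¹ := by
    refine intervalIntegral.integral_eq_sub_of_hasDerivAt (f := fun t => -(a + t)⁻¹)
      (fun t ht => ?_) ((continuous_inv_add_abs_sq ha).intervalIntegrable _ _)
    rw [Set.uIcc_of_le hpi.le] at ht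
    have hne : a + t ≠ 0 := by linarith [ht.1]
    rw [abs_of_nonneg ht.1]
    convert! (((hasDerivAt_id t).const_add a).inv hne).neg using 1
    simp [neg_div]
  rw [h2]
  have : 0 < (a + π)⁻¹ := by positivity
  simp only [add_zero]
  linarith

theorem integral_inv_add_norm {a : ℝ} (ha : 0 < a) :
    ∫ z : AddCircle (2 * π), (a + ‖z‖)⁻¹ = 2 * (log (a + π) - log a) := by
  have hpi := pi_pos
  have hc : Continuous fun t : ℝ => (a + |t|)⁻¹ :=
    Continuous.inv₀ (by fun_prop) fun t => by positivity
  have h := integral_comp_norm_addCircle hc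
  simp only [abs_norm] at h
  rw [h]
  have h2 : ∫ t in 0..π, (a + |t|)⁻¹ = log (a + π) - log (a + 0) := by
    refine intervalIntegral.integral_eq_sub_of_hasDerivAt (f := fun t => log (a + t))
      (fun t ht => ?_) (hc.intervalIntegrable _ _)
    rw [Set.uIcc_of_le hpi.le] at ht
    have hne : a + t ≠ 0 := by linarith [ht.1]
    rw [abs_of_nonneg ht.1]
    simpa using ((hasDerivAt_id t).const_add a).log hne
  rw [h2, add_zero]

theorem continuous_inv_add_norms_sq {δ : ℝ} (hδ : 0 < δ) :
    Continuous fun p : AddCircle (2 * π) × AddCircle (2 * π) => ((δ + ‖p.1‖ + ‖p.2‖) ^ 2)⁻¹ := by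
  refine Continuous.inv₀ (by fun_prop) fun p => ?_
  positivity

/-- By Fubini, one integration leaves at most `2 / (δ + ‖z‖)` and the second gives `4 * (log (δ + π)
- log δ)`. Since `log (δ + π) ≤ 2 ≤ 2 * -log δ`, the constant is `4 * 3`. -/
theorem integral_inv_add_norms_sq_le {δ : ℝ} (hδ : 0 < δ) (hδ' : δ ≤ exp (-1)) :
    ∫ x : Torus2, ((δ + ‖x 0‖ + ‖x 1‖) ^ 2)⁻¹ ≤ 12 * -log δ := by
  have hmp := volume_preserving_finTwoArrow (AddCircle (2 * π))
  have hcont := continuous_inv_add_norms_sq hδ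
  have e1 : ∫ x : Torus2, ((δ + ‖x 0‖ + ‖x 1‖) ^ 2)⁻¹ =
      ∫ p : AddCircle (2 * π) × AddCircle (2 * π), ((δ + ‖p.1‖ + ‖p.2‖) ^ 2)⁻¹ :=
    hmp.integral_comp (MeasurableEquiv.finTwoArrow).measurableEmbedding
      fun p => ((δ + ‖p.1‖ + ‖p.2‖) ^ 2)⁻¹
  have hint : Integrable (fun p : AddCircle (2 * π) × AddCircle (2 * π) =>
      ((δ + ‖p.1‖ + ‖p.2‖) ^ 2)⁻¹) (volume.prod volume) := by
    obtain ⟨C, hC⟩ := isCompact_univ.exists_bound_of_continuousOn hcont.continuousOn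
    exact Integrable.of_bound hcont.aestronglyMeasurable C
      (ae_of_all _ fun p => hC p (Set.mem_univ _))
  have hint2 : Integrable (fun z : AddCircle (2 * π) => 2 * (δ + ‖z‖)⁻¹) volume := by
    have hc : Continuous fun z : AddCircle (2 * π) => 2 * (δ + ‖z‖)⁻¹ :=
      continuous_const.mul (Continuous.inv₀ (by fun_prop) fun z => by positivity)
    obtain ⟨C, hC⟩ := isCompact_univ.exists_bound_of_continuousOn hc.continuousOn
    exact Integrable.of_bound hc.aestronglyMeasurable C
      (ae_of_all _ fun p => hC p (Set.mem_univ _))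
  have hlog1 : log δ ≤ -1 := by
    have := log_le_log hδ hδ'
    rwa [log_exp] at this
  have hlog2 : log (δ + π) ≤ 2 := by
    have h1 : δ ≤ 1 / 2 := by
      refine hδ'.trans ?_
      rw [exp_neg, inv_le_comm₀ (exp_pos _) (by norm_num)]
      linarith [exp_one_gt_d9]
    have h2 : δ + π ≤ exp 1 * exp 1 := by
      nlinarith [exp_one_gt_d9, pi_lt_d2]
    rw [← exp_add] at h2
    have := log_le_log (by positivity) h2
    rw [log_exp] at this
    linarith
  rw [e1]
  change ∫ p, _ ∂(volume.prod volume) ≤ _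
  rw [integral_prod _ hint]
  calc _ ≤ ∫ z : AddCircle (2 * π), 2 * (δ + ‖z‖)⁻¹ :=
        integral_mono hint.integral_prod_left hint2 fun z =>
          integral_inv_add_norm_sq_le (a := δ + ‖z‖) (by positivity)
    _ = 4 * (log (δ + π) - log δ) := by
        rw [integral_const_mul, integral_inv_add_norm hδ]; ring
    _ ≤ _ := by linarith


/-! ### Logarithmic capacity of small balls -/

/-- The smooth function `2 - cos x₀ - cos x₁`, comparable to the squared distance to the origin. -/
noncomputable def versine (x : Torus2) : ℝ := 2 - cosCoord 0 x - cosCoord 1 x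

/-- The regularised logarithm `log (5 / (δ² + versine x))`, a test function for the capacity of
the ball of radius `δ`. -/
noncomputable def logCap (δ : ℝ) (x : Torus2) : ℝ := log 5 - log (δ ^ 2 + versine x)

theorem cosCoord_bounds (i : Fin 2) (x : Torus2) :
    1 - ‖x i‖ ^ 2 / 2 ≤ cosCoord i x ∧ cosCoord i x ≤ 1 - ‖x i‖ ^ 2 / 8 := by
  obtain ⟨t, ht, ht'⟩ := exists_coe_eq_abs_eq_norm (x i)
  have hc : cosCoord i x = cos t := by rw [cosCoord, ← ht]; exact Real.Angle.cos_coe t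
  have hpi : |t| ≤ π := by
    rw [ht']
    have := AddCircle.norm_le_half_period (2 * π) (x := x i) two_pi_pos.ne'
    rw [abs_of_pos two_pi_pos] at this
    linarith
  rw [hc, ← ht', sq_abs]
  refine ⟨one_sub_sq_div_two_le_cos, (cos_le_one_sub_mul_cos_sq hpi).trans ?_⟩
  have : 1 / 8 ≤ 2 / π ^ 2 := by
    rw [div_le_div_iff₀ (by norm_num) (by positivity)]
    nlinarith [pi_pos, pi_lt_d2]
  nlinarith [sq_nonneg t]

theorem versine_le (x : Torus2) : versine x ≤ ‖x‖ ^ 2 := by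
  have h0 := (cosCoord_bounds 0 x).1
  have h1 := (cosCoord_bounds 1 x).1
  have n0 : ‖x 0‖ ^ 2 ≤ ‖x‖ ^ 2 := by gcongr; exact norm_le_pi_norm x 0
  have n1 : ‖x 1‖ ^ 2 ≤ ‖x‖ ^ 2 := by gcongr; exact norm_le_pi_norm x 1
  unfold versine
  linarith

theorem le_versine (x : Torus2) : (‖x 0‖ ^ 2 + ‖x 1‖ ^ 2) / 8 ≤ versine x := by
  have h0 := (cosCoord_bounds 0 x).2
  have h1 := (cosCoord_bounds 1 x).2
  unfold versine
  linarith

theorem versine_nonneg (x : Torus2) : 0 ≤ versine x :=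
  le_trans (by positivity) (le_versine x)

theorem versine_le_four (x : Torus2) : versine x ≤ 4 := by
  have h : ∀ i, -1 ≤ cosCoord i x := fun i => by
    have h1 : cosCoord i x ^ 2 + sinCoord i x ^ 2 = 1 := Real.Angle.cos_sq_add_sin_sq _
    nlinarith [sq_nonneg (sinCoord i x)]
  unfold versine
  linarith [h 0, h 1]

theorem smooth_versine : Smooth versine :=
  ContDiff.sub (ContDiff.sub contDiff_const (smooth_cosCoord 0)) (smooth_cosCoord 1)

theorem sq_add_versine_pos {δ : ℝ} (hδ : 0 < δ) (x : Torus2) : 0 < δ ^ 2 + versine x := by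
  have := versine_nonneg x
  positivity

theorem smooth_logCap {δ : ℝ} (hδ : 0 < δ) : Smooth (logCap δ) :=
  ContDiff.sub contDiff_const
    (ContDiff.log (ContDiff.add contDiff_const smooth_versine)
      fun x => (sq_add_versine_pos hδ (mk x)).ne')

theorem partialDeriv_eq_deriv_axis (i : Fin 2) (φ : Torus2 → ℝ) (x : Torus2) :
    partialDeriv i φ x = deriv (fun t => φ (x + axis i t)) 0 := by
  simp only [partialDeriv, axis]

theorem hasDerivAt_cosCoord (i j : Fin 2) (x : Torus2) :
    HasDerivAt (fun t => cosCoord j (x + axis i t)) (if j = i then -sinCoord i x else 0) 0 := by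
  obtain ⟨y, rfl⟩ := isOpenQuotientMap_mk.surjective x
  simp only [axis_eq_mk, ← mk_add, cosCoord_mk, sinCoord_mk, Pi.add_apply]
  split_ifs with h
  · subst h
    simp only [Pi.single_eq_same]
    simpa using ((hasDerivAt_id (0 : ℝ)).const_add (y j)).cos
  · simp only [Pi.single_eq_of_ne h]
    exact hasDerivAt_const _ _

theorem hasDerivAt_versine (i : Fin 2) (x : Torus2) :
    HasDerivAt (fun t => versine (x + axis i t)) (sinCoord i x) 0 := by
  have := ((hasDerivAt_cosCoord i 0 x).const_sub 2).sub (hasDerivAt_cosCoord i 1 x)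
  convert! this using 1
  fin_cases i <;> simp

theorem partialDeriv_logCap {δ : ℝ} (hδ : 0 < δ) (i : Fin 2) (x : Torus2) :
    partialDeriv i (logCap δ) x = -(sinCoord i x / (δ ^ 2 + versine x)) := by
  rw [partialDeriv_eq_deriv_axis]
  have h := (((hasDerivAt_versine i x).const_add (δ ^ 2)).log (by
    rw [axis_zero, add_zero]; exact (sq_add_versine_pos hδ x).ne')).const_sub (log 5)
  rw [axis_zero, add_zero] at h
  exact h.deriv

theorem sinCoord_sq_le (x : Torus2) : ∑ i, sinCoord i x ^ 2 ≤ 2 * versine x := by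
  have h : ∀ i, sinCoord i x ^ 2 ≤ 2 * (1 - cosCoord i x) := fun i => by
    have h1 : cosCoord i x ^ 2 + sinCoord i x ^ 2 = 1 := Real.Angle.cos_sq_add_sin_sq _
    nlinarith [sq_nonneg (1 - cosCoord i x)]
  rw [Fin.sum_univ_two, versine]
  linarith [h 0, h 1]

/-- The 5 in the definition of `logCap` is chosen for this: `δ ^ 2 ≤ 1` and `versine x ≤ 4`. -/
theorem logCap_nonneg {δ : ℝ} (hδ : 0 < δ) (hδ1 : δ ≤ 1) (x : Torus2) : 0 ≤ logCap δ x :=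
  sub_nonneg.2 (log_le_log (sq_add_versine_pos hδ x) (by nlinarith [versine_le_four x]))

/-- From `log w ≤ 2 * √w`. This crude bound suffices, as it matches the size of the gradient term.
-/
theorem logCap_sq_le {δ : ℝ} (hδ : 0 < δ) (hδ1 : δ ≤ 1) (x : Torus2) :
    logCap δ x ^ 2 ≤ 20 * (δ ^ 2 + versine x)⁻¹ := by
  have hz := sq_add_versine_pos hδ x
  have h0 := logCap_nonneg hδ hδ1 x
  have hw : 0 < 5 / (δ ^ 2 + versine x) := by positivity
  have h1 : logCap δ x ≤ 2 * √(5 / (δ ^ 2 + versine x)) := by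
    rw [logCap, ← log_div (by norm_num) hz.ne']
    have h2 := log_le_sub_one_of_pos (sqrt_pos.2 hw)
    rw [log_sqrt hw.le] at h2
    linarith
  calc logCap δ x ^ 2 ≤ (2 * √(5 / (δ ^ 2 + versine x))) ^ 2 := by gcongr
    _ = 20 * (δ ^ 2 + versine x)⁻¹ := by rw [mul_pow, sq_sqrt hw.le]; ring

theorem h1_density_logCap_le {δ : ℝ} (hδ : 0 < δ) (hδ1 : δ ≤ 1) (x : Torus2) :
    logCap δ x ^ 2 + ∑ i, partialDeriv i (logCap δ) x ^ 2 ≤ 22 * (δ ^ 2 + versine x)⁻¹ := by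
  have hz := sq_add_versine_pos hδ x
  have h1 := logCap_sq_le hδ hδ1 x
  -- The squared gradient of `versine` is at most `2 * versine`, which cancels one power of the
  -- denominator.
  have h2 : ∑ i, partialDeriv i (logCap δ) x ^ 2 ≤ 2 * (δ ^ 2 + versine x)⁻¹ := by
    simp only [partialDeriv_logCap hδ, neg_sq, div_pow]
    rw [← Finset.sum_div, div_le_iff₀ (by positivity)]
    refine (sinCoord_sq_le x).trans ?_
    rw [sq (δ ^ 2 + versine x), ← mul_assoc, inv_mul_cancel_right₀ hz.ne']
    nlinarith [sq_nonneg δ]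
  linarith

theorem inv_sq_add_versine_le {δ : ℝ} (hδ : 0 < δ) (x : Torus2) :
    (δ ^ 2 + versine x)⁻¹ ≤ 24 * ((δ + ‖x 0‖ + ‖x 1‖) ^ 2)⁻¹ := by
  have h := le_versine x
  have hz := sq_add_versine_pos hδ x
  rw [← div_eq_mul_inv, inv_le_comm₀ hz (by positivity), inv_div, div_le_iff₀ (by norm_num)]
  nlinarith [sq_nonneg (δ - ‖x 0‖), sq_nonneg (δ - ‖x 1‖), sq_nonneg (‖x 0‖ - ‖x 1‖)]

/-- The squared norm is at most `22 * 24 * 12 * -log δ`, and `22 * 24 * 12 = 6336 ≤ 80 ^ 2`. -/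
theorem h1Norm_logCap_le {δ : ℝ} (hδ : 0 < δ) (hδ' : δ ≤ exp (-1)) :
    h1Norm (logCap δ) ≤ 80 * √(-log δ) := by
  have hδ1 : δ ≤ 1 := hδ'.trans (exp_le_one_iff.2 (by norm_num))
  have hL : 0 ≤ -log δ := by linarith [log_nonpos hδ.le hδ1]
  have hs := smooth_logCap hδ
  have hc1 : Continuous fun x => logCap δ x ^ 2 + ∑ i, partialDeriv i (logCap δ) x ^ 2 :=
    (hs.continuous.pow 2).add
      (continuous_finsetSum _ fun i _ => (hs.continuous_partialDeriv i).pow 2)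
  have hc2 : Continuous fun x : Torus2 => 528 * ((δ + ‖x 0‖ + ‖x 1‖) ^ 2)⁻¹ :=
    continuous_const.mul (Continuous.inv₀ (by fun_prop) fun x => by positivity)
  have hint : ∀ {φ : Torus2 → ℝ}, Continuous φ → Integrable φ volume := fun hφ =>
    memLp_one_iff_integrable.1 (memLp_of_continuous hφ 1)
  rw [h1Norm, sqrt_le_left (by positivity), mul_pow, sq_sqrt hL]
  calc _ ≤ ∫ x : Torus2, 528 * ((δ + ‖x 0‖ + ‖x 1‖) ^ 2)⁻¹ :=
        integral_mono (hint hc1) (hint hc2) fun x =>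
          (h1_density_logCap_le hδ hδ1 x).trans (by linarith [inv_sq_add_versine_le hδ x])
    _ ≤ 528 * (12 * -log δ) := by
        rw [integral_const_mul]
        gcongr
        exact integral_inv_add_norms_sq_le hδ hδ'
    _ ≤ _ := by linarith

theorem le_logCap {δ : ℝ} (hδ : 0 < δ) {x : Torus2} (hx : ‖x‖ ≤ δ) :
    2 * -log δ ≤ logCap δ x := by
  have hz := sq_add_versine_pos hδ x
  have h1 : δ ^ 2 + versine x ≤ 5 * δ ^ 2 := by
    have h2 := versine_le x
    have h3 : ‖x‖ ^ 2 ≤ δ ^ 2 := by gcongr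
    nlinarith [sq_nonneg δ]
  have h4 := log_le_log hz h1
  rw [log_mul (by norm_num) (by positivity), log_pow] at h4
  rw [logCap]
  push_cast at h4
  linarith

/-- A measure in `H⁻¹` charges a ball of radius `δ` by at most `O((log 1/δ)^{-1/2})`. -/
theorem IsHNegBound.measureReal_closedBall_le {μ : Measure Torus2} [IsFiniteMeasure μ] {K : ℝ}
    (hK : IsHNegBound μ K) {δ : ℝ} (hδ : 0 < δ) (hδ' : δ ≤ exp (-1)) (a : Torus2) :
    μ.real (closedBall a δ) ≤ K * (40 / √(-log δ)) := by
  have hδ1 : δ ≤ 1 := hδ'.trans (exp_le_one_iff.2 (by norm_num))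
  have hL : 0 < -log δ := by
    have := log_le_log hδ hδ'
    rw [log_exp] at this
    linarith
  have hs := (smooth_logCap hδ).comp_sub a
  have h1 := hK.2 _ hs
  rw [h1Norm_comp_sub] at h1
  have h2 := (le_abs_self _).trans (h1.trans
    (mul_le_mul_of_nonneg_left (h1Norm_logCap_le hδ hδ') hK.1))
  have hi : Integrable (fun x => logCap δ (x - a)) μ := by
    obtain ⟨C, hC⟩ := isCompact_univ.exists_bound_of_continuousOn hs.continuous.continuousOn
    exact Integrable.of_bound hs.continuous.aestronglyMeasurable C
      (ae_of_all _ fun x => hC x (Set.mem_univ _))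
  -- The test function is nonnegative and at least `2 * -log δ` on the ball, whereas its integral is
  -- at most `80 * K * √(-log δ)`; the quotient gives the 40.
  have h3 : (2 * -log δ) * μ.real (closedBall a δ) ≤ ∫ x, logCap δ (x - a) ∂μ := by
    calc (2 * -log δ) * μ.real (closedBall a δ)
        = ∫ x in closedBall a δ, 2 * -log δ ∂μ := by
          rw [setIntegral_const, smul_eq_mul, mul_comm]
      _ ≤ ∫ x in closedBall a δ, logCap δ (x - a) ∂μ := by
          refine setIntegral_mono_on (integrable_const _) hi.integrableOn
            isClosed_closedBall.measurableSet fun x hx => le_logCap hδ ?_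
          rwa [mem_closedBall, dist_eq_norm] at hx
      _ ≤ _ := setIntegral_le_integral hi (ae_of_all _ fun x => logCap_nonneg hδ hδ1 _)
  have hsq : √(-log δ) * √(-log δ) = -log δ := mul_self_sqrt hL.le
  have hpos : 0 < √(-log δ) := sqrt_pos.2 hL
  have h4 := h3.trans h2
  rw [← mul_div_assoc, le_div_iff₀ hpos]
  have h5 : √(-log δ) * (μ.real (closedBall a δ) * √(-log δ)) ≤ √(-log δ) * (K * 40) := by
    linear_combination (1 / 2) * h4 + μ.real (closedBall a δ) * hsq
  exact le_of_mul_le_mul_left h5 hpos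


/-! ### Non-concentration of f and the choice of scale -/

theorem MemHNeg.isHNegBound_hNegNorm {μ : Measure Torus2} (h : MemHNeg μ) :
    IsHNegBound μ (hNegNorm μ) := by
  refine ⟨le_csInf h fun K hK => hK.1, fun φ hφ => ?_⟩
  have hn : 0 ≤ h1Norm φ := sqrt_nonneg _
  rcases hn.eq_or_lt with h0 | h0
  · obtain ⟨K, hK⟩ := h
    simpa [← h0] using hK.2 φ hφ
  · rw [← div_le_iff₀ h0]
    exact le_csInf h fun K hK => (div_le_iff₀ h0).2 (hK.2 φ hφ)

theorem setIntegral_abs_le_lpNorm {w : Torus2 → ℝ} {p : ℝ≥0∞} (hp : 1 ≤ p)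
    (hw : MemLp w p volume) {δ : ℝ} (hδ : 0 ≤ δ) (hδ' : δ ≤ π) (a : Torus2) :
    ∫ x in closedBall a δ, |w x| ≤ lpNorm w p volume * (4 * δ ^ 2) ^ (1 - 1 / p.toReal) := by
  have hq : 0 ≤ 1 - 1 / p.toReal := by
    rcases eq_or_ne p ⊤ with rfl | h
    · simp
    · have : 1 ≤ p.toReal := by simpa using ENNReal.toReal_mono h hp
      rw [sub_nonneg, div_le_one (by linarith)]
      exact this
  have h1 := eLpNorm_le_eLpNorm_mul_rpow_measure_univ hp
    (hw.1.restrict (s := closedBall a δ))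
  rw [Measure.restrict_apply_univ, volume_closedBall a hδ hδ', ENNReal.toReal_one, one_div_one,
    ENNReal.ofReal_rpow_of_nonneg (by positivity) hq] at h1
  have h2 := h1.trans (mul_le_mul_left (eLpNorm_restrict_le w p volume (closedBall a δ)) _)
  rw [← ofReal_lpNorm hw, ← ENNReal.ofReal_mul lpNorm_nonneg, eLpNorm_one_eq_lintegral_enorm,
    ← ofReal_integral_norm_eq_lintegral_enorm (hw.integrable hp).integrableOn] at h2
  exact (ENNReal.ofReal_le_ofReal_iff
    (mul_nonneg lpNorm_nonneg (rpow_nonneg (by positivity) _))).1 h2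

/-- With `L = -log δ ≥ 1`, the left side is at most `4 * exp (-2 * q * L)`; then `exp (2 * q * L) ≥
2 * q * L` and `√L ≤ L` suffice. -/
theorem four_mul_sq_rpow_le {q δ : ℝ} (hq : 0 < q) (hq1 : q ≤ 1) (hδ : 0 < δ)
    (hδ' : δ ≤ exp (-1)) : (4 * δ ^ 2) ^ q ≤ 2 / q / √(-log δ) := by
  have hL : 1 ≤ -log δ := by
    have := log_le_log hδ hδ'
    rw [log_exp] at this
    linarith
  have hpos : 0 < √(-log δ) := sqrt_pos.2 (by linarith)
  have h1 : (4 * δ ^ 2) ^ q ≤ 4 * exp (-(2 * q * -log δ)) := by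
    rw [mul_rpow (by norm_num) (by positivity)]
    have h2 : (δ ^ 2) ^ q = exp (-(2 * q * -log δ)) := by
      rw [rpow_def_of_pos (by positivity), log_pow]
      congr 1
      push_cast
      ring
    have h3 : (4 : ℝ) ^ q ≤ 4 := by
      simpa using rpow_le_rpow_of_exponent_le (by norm_num : (1 : ℝ) ≤ 4) hq1
    rw [h2]
    gcongr
  have h4 : √(-log δ) ≤ -log δ := by
    rw [sqrt_le_left (by linarith)]
    nlinarith
  have h5 := add_one_le_exp (2 * q * -log δ)
  refine h1.trans ?_
  rw [exp_neg, le_div_iff₀ hpos, le_div_iff₀ hq]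
  have hexp := exp_pos (2 * q * -log δ)
  have h6 : 4 * (exp (2 * q * -log δ))⁻¹ * √(-log δ) * q =
      (4 * √(-log δ) * q) / exp (2 * q * -log δ) := by ring
  rw [h6, div_le_iff₀ hexp]
  nlinarith

/-- The integral of `f - w` over any measurable set is its `μ`-mass, so `f - w ≥ 0` almost
everywhere and `|f| ≤ (f - w) + |w|`. -/
theorem setIntegral_abs_le_of_withDensity_eq {f w : Torus2 → ℝ} {μ : Measure Torus2}
    [IsFiniteMeasure μ] (hf : Integrable f volume) (hw : Integrable w volume)
    (h : volume.withDensityᵥ f = μ.toSignedMeasure + volume.withDensityᵥ w) {s : Set Torus2}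
    (hs : MeasurableSet s) :
    ∫ x in s, |f x| ≤ μ.real s + ∫ x in s, |w x| := by
  have hdiff : ∀ t, MeasurableSet t → ∫ x in t, (f x - w x) = μ.real t := fun t ht => by
    have := congrArg (fun m : SignedMeasure Torus2 => m t) h
    simp only [_root_.add_apply, withDensityᵥ_apply hf ht, withDensityᵥ_apply hw ht,
      Measure.toSignedMeasure_apply_measurable ht] at this
    rw [integral_sub hf.integrableOn hw.integrableOn, this]
    ring
  have hfw : Integrable (fun x => f x - w x) volume := hf.sub hw
  have hnn : 0 ≤ᵐ[volume] fun x => f x - w x :=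
    ae_nonneg_of_forall_setIntegral_nonneg hfw fun t ht _ => by
      have := hdiff t ht
      rw [this]
      exact measureReal_nonneg
  rw [← hdiff s hs, ← integral_add hfw.integrableOn hw.abs.integrableOn]
  refine integral_mono_ae hf.abs.integrableOn
    (hfw.integrableOn.add hw.abs.integrableOn) (ae_restrict_of_ae ?_)
  filter_upwards [hnn] with x hx
  have hx' : 0 ≤ f x - w x := hx
  have := abs_add_le (f x - w x) (w x)
  rwa [sub_add_cancel, abs_of_nonneg hx'] at this

/-- The choice of scale `δ² = 1 / (N (log N)^{1/4})`. -/
theorem exists_scale {N : ℝ} (hN : exp 2 < N) :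
    ∃ δ : ℝ, 0 < δ ∧ δ ≤ exp (-1) ∧ δ ^ 2 * (N * log N ^ (1 / 4 : ℝ)) = 1 ∧
      (log N ^ (1 / 4 : ℝ)) ^ 2 / 2 ≤ √(-log δ) := by
  have hN0 : 0 < N := (exp_pos 2).trans hN
  have hl : 2 < log N := (lt_log_iff_exp_lt hN0).2 hN
  set m := log N ^ (1 / 4 : ℝ) with hm
  have hm1 : 1 ≤ m := one_le_rpow (by linarith) (by norm_num)
  have hm4 : m ^ 4 = log N := by
    rw [hm, ← rpow_natCast, ← rpow_mul (by linarith)]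
    norm_num
  have hNm : 0 < N * m := by positivity
  -- As `m ≥ 1`, this is at least `log N / 2`. That exceeds 1 because `N > exp 2`, and it dominates
  -- `(m ^ 2 / 2) ^ 2` because `log N = m ^ 4`.
  have hlog : -log (√(N * m))⁻¹ = (log N + log m) / 2 := by
    rw [log_inv, neg_neg, log_sqrt hNm.le, log_mul hN0.ne' (by positivity)]
  have hlm : 0 ≤ log m := log_nonneg hm1
  refine ⟨(√(N * m))⁻¹, by positivity, ?_, ?_, ?_⟩
  · rw [← log_le_iff_le_exp (by positivity)]
    linarith
  · rw [inv_pow, sq_sqrt hNm.le, inv_mul_cancel₀ hNm.ne']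
  · rw [hlog]
    refine le_sqrt_of_sq_le ?_
    rw [div_pow, ← pow_mul, hm4]
    linarith

end Torus2

theorem proposition4p1 (p : ℝ≥0∞) (hp : 1 < p) :
    ∃ C : ℝ, 0 < C ∧
      ∀ (f : Torus2 → ℝ) (G : Torus2 → EuclideanSpace ℝ (Fin 2))
        (μ : Measure Torus2) [IsFiniteMeasure μ] (w : Torus2 → ℝ),
        Torus2.HasH1Gradient f G →
        ∫ x, f x = 0 →
        Torus2.MemHNeg μ →
        MemLp w p volume →
        volume.withDensityᵥ f = μ.toSignedMeasure + volume.withDensityᵥ w →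
        Real.exp 2 < lpNorm G 2 volume →
        lpNorm f 2 volume ^ 2 ≤
          C * (lpNorm f 1 volume *
                (Torus2.hNegNorm μ + lpNorm w p volume + lpNorm f 1 volume) + 1) *
            (lpNorm G 2 volume / Real.log (lpNorm G 2 volume) ^ (1 / 4 : ℝ)) := by
  -- For `p = ⊤`, `p.toReal = 0` and `1 / 0 = 0`, so `q = 1`, the correct Hölder exponent.
  set q := 1 - 1 / p.toReal with hq
  have hq1 : q ≤ 1 := by
    have : 0 ≤ 1 / p.toReal := by positivity
    linarith
  have hq0 : 0 < q := by
    rcases eq_or_ne p ⊤ with rfl | h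
    · simp [hq]
    · have : 1 < p.toReal := by
        simpa using (ENNReal.toReal_lt_toReal ENNReal.one_ne_top h).2 hp
      rw [hq, sub_pos, div_lt_one (by linarith)]
      exact this
  -- The 40 comes from the capacity bound for `μ`, the `2 / q` from the Hölder bound for `w`.
  refine ⟨40 + 2 / q, by positivity, fun f G μ _ w h _ hμ hw hfw hN => ?_⟩
  obtain ⟨δ, hδ, hδ1, hδ2, hδ3⟩ := Torus2.exists_scale hN
  have hN0 : 0 < lpNorm G 2 volume := (exp_pos 2).trans hN
  have hl : 2 < log (lpNorm G 2 volume) := (lt_log_iff_exp_lt hN0).2 hN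
  have hδπ : δ ≤ π := by
    have : exp (-1) ≤ 1 := exp_le_one_iff.2 (by norm_num)
    linarith [pi_gt_three]
  have hK := hμ.isHNegBound_hNegNorm
  have hA : 0 ≤ lpNorm f 1 volume := lpNorm_nonneg
  have hW : 0 ≤ lpNorm w p volume := lpNorm_nonneg
  set K := Torus2.hNegNorm μ
  set W := lpNorm w p volume
  set A := lpNorm f 1 volume
  set N := lpNorm G 2 volume
  set m := log N ^ (1 / 4 : ℝ)
  have hm : 0 < m := rpow_pos_of_pos (by linarith) _
  have hK0 : 0 ≤ K := hK.1
  have hL : 0 < √(-log δ) := lt_of_lt_of_le (by positivity) hδ3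
  have hinv : (√(-log δ))⁻¹ ≤ 2 / m ^ 2 := by
    rw [inv_le_comm₀ hL (by positivity), inv_div]
    exact hδ3
  have hS : ∀ x, ∫ y in Metric.closedBall x δ, |f y| ≤ (40 + 2 / q) * (K + W) * (2 / m ^ 2) := by
    intro x
    have h1 := Torus2.setIntegral_abs_le_of_withDensity_eq (h.memLp.integrable (by norm_num))
      (hw.integrable hp.le) hfw (Metric.isClosed_closedBall (x := x) (ε := δ)).measurableSet
    have h2 := hK.measureReal_closedBall_le hδ hδ1 x
    have h3 := Torus2.setIntegral_abs_le_lpNorm hp.le hw hδ.le hδπ x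
    have h4 := mul_le_mul_of_nonneg_left (Torus2.four_mul_sq_rpow_le hq0 hq1 hδ hδ1) hW
    calc _ ≤ K * (40 / √(-log δ)) + W * (2 / q / √(-log δ)) := by linarith
      _ = (40 * K + 2 / q * W) * (√(-log δ))⁻¹ := by ring
      _ ≤ (40 + 2 / q) * (K + W) * (2 / m ^ 2) := by
        have : 40 * K + 2 / q * W ≤ (40 + 2 / q) * (K + W) := by
          have : 0 ≤ 2 / q * K := by positivity
          nlinarith
        gcongr
  refine (h.lpNorm_sq_le_of_setIntegral_closedBall_le hδ hδπ hS).trans ?_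
  have hδeq : δ ^ 2 = (N * m)⁻¹ := eq_inv_of_mul_eq_one_left hδ2
  rw [hδeq]
  -- At this scale both terms become multiples of `N / m`; the leftover 4 is absorbed since `4 ≤ 40
  -- + 2 / q`.
  have e : A * ((40 + 2 / q) * (K + W) * (2 / m ^ 2)) / (2 * (N * m)⁻¹) + 4 * (N * m)⁻¹ * N ^ 2 =
      ((40 + 2 / q) * (A * (K + W)) + 4) * (N / m) := by
    field_simp
  rw [e]
  have hq2 : 0 < 2 / q := by positivity
  gcongr
  nlinarith [mul_nonneg (by positivity : 0 ≤ 40 + 2 / q) (mul_nonneg hA hA)]
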